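/- **Theorem (almost-sure Hewitt–Savage zero-one law).** Let $X$ be a standard Borel space, let $PX$ be the space of probability measures on $X$ (with the $\sigma$-algebra generated by the evaluations $q\mapsto q(A)$), and let $p$ be an exchangeable probability measure on $X^{\mathbb N}$, i.e. one that is invariant under the action of the group $S_\infty$ of finite permutations of $\mathbb N$ permuting the components. *Terminology.* Two Markov kernels $f,g:(\Omega,p)\to Y$ are $p$-a.s. equal, $f\simeq_p g$, if for every measurable $B\subseteq Y$ one has $f(B|\omega)=g(B|\omega)$ for $p$-almost all $\omega$. A kernel $f$ is $p$-a.s. deterministic if $\mathrm{copy}\circ f\simeq_p (f\otimes f)\circ\mathrm{copy}$; a probability measure $q$ on $Y$ is deterministic if $\mathrm{copy}\circ q=q\otimes q$. A kernel $f:X^{\mathbb N}\to Y$ is $p$-a.s. permutation-invariant if $f\circ\sigma\simeq_p f$ for every $\sigma\in S_\infty$. A measurable $A\subseteq X^{\mathbb N}$ is a.s. invariant if $1_A\circ\sigma=1_A$ $p$-almost surely for every $\sigma\in S_\infty$; these sets form the invariant $\sigma$-algebra $\Sigma_{\mathrm{inv}}$. An *invariant object* is a standard Borel probability space $(X_{\mathrm{inv}},p_{\mathrm{inv}})$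 with a measure-preserving, $p$-a.s. permutation-invariant Markov kernel $r:(X^{\mathbb N},p)\to(X_{\mathrm{inv}},p_{\mathrm{inv}})$ such that every measure-preserving, $p$-a.s. permutation-invariant Markov kernel $f:(X^{\mathbb N},p)\to(Y,q)$ to a standard Borel probability space is $p$-a.s. equal to $\tilde f\circ r$ for a measure-preserving Markov kernel $\tilde f:(X_{\mathrm{inv}},p_{\mathrm{inv}})\to(Y,q)$, unique up to $p_{\mathrm{inv}}$-a.s. equality, and $f$ is $p$-a.s. deterministic if and only if $\tilde f$ is $p_{\mathrm{inv}}$-a.s. deterministic. There is a unique probability measure $\mu$ on $PX$ (the de Finetti measure of $p$) such that $p=\int_{PX} q^{\otimes\mathbb N}\,\mu(dq)$, and an invariant object exists. For this $\mu$ and for every invariant object $(X_{\mathrm{inv}},p_{\mathrm{inv}},r)$, the following conditions are equivalent: 1. $p$ is ergodic under finite permutations: $p(A)\in\{0,1\}$ for every a.s. invariant set $A$. 2. $p_{\mathrm{inv}}$ is deterministic, where the invariant object is either (2a) $X^{\mathbb N}$ equipped with the $\sigma$-algebra $\Sigma_{\mathrm{inv}}$ and the restriction of $p$, or (2b) the given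 standard Borel invariant object $(X_{\mathrm{inv}},p_{\mathrm{inv}},r)$. 3. For every standard Borel space $Y$ and every $p$-a.s. deterministic, $p$-a.s. permutation-invariant Markov kernel $s:X^{\mathbb N}\to Y$, the measure $s\circ p$ is deterministic. 4. $\mu$ is the Dirac measure $\delta_q$ at some $q\in PX$. 5. (5a) The coordinates of $X^{\mathbb N}$ are independent under $p$; equivalently, (5b) $p$ is the i.i.d. product $q^{\otimes\mathbb N}$ for some $q\in PX$. (All of 1, 2a, 2b, 3, 4, 5a, 5b are equivalent.) -/

import Mathlib

open MeasureTheory ProbabilityTheory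

universe u

noncomputable section

/-! Markov kernels up to almost sure equality -/

section Kernels

variable {α β γ : Type u} [MeasurableSpace α] [MeasurableSpace β] [MeasurableSpace γ]

/-- Two kernels `f, g : α → β` are `p`-almost surely equal: for every measurable `B`,
`f(B|x) = g(B|x)` for `p`-almost all `x`. -/
def ASEq (p : Measure α) (f g : Kernel α β) : Prop :=
  ∀ B : Set β, MeasurableSet B → ∀ᵐ x ∂p, f x B = g x B

/-- `f` is `p`-almost surely deterministic: copying the output of `f` is `p`-almost surely the
same as running `f` twice, independently, on two copies of the input. -/
def ASDeterministic (p : Measure α) (f : Kernel α β) : Prop :=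
  ASEq p (Kernel.copy β ∘ₖ f) ((f ∥ₖ f) ∘ₖ Kernel.copy α)

/-- A state (probability measure) is deterministic: copying it gives two independent copies. -/
def IsDeterministicState (q : Measure α) : Prop :=
  (Kernel.copy α) ∘ₘ q = q.prod q

/-- `f` represents a morphism `(α, p) → (β, q)`: it is a measure-preserving Markov kernel. -/
structure IsMorphism (p : Measure α) (q : Measure β) (f : Kernel α β) : Prop where
  isMarkovKernel : IsMarkovKernel f
  preserves : f ∘ₘ p = q

end Kernels

/-! Invariance, ergodicity, invariant objects for a family `D` of kernels acting on `(α, p)`.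
The monoid structure of the indexing set plays no role in these notions. -/

section Invariance

variable {ι : Type*} {α : Type u} [MeasurableSpace α]

/-- `f : (α, p) → (β, q)` is `p`-almost surely (right-)invariant. -/
def ASInvariant (D : ι → Kernel α α) (p : Measure α)
    {β : Type u} [MeasurableSpace β] (f : Kernel α β) : Prop :=
  ∀ m : ι, ASEq p (f ∘ₖ D m) f

/-- `A` is a `p`-almost surely invariant measurable set: for every `m`, `m(A|x) = 1_A(x)` for
`p`-almost all `x`. -/
structure IsASInvariantSet (D : ι → Kernel α α) (p : Measure α) (A : Set α) : Prop where
  measurableSet : MeasurableSet A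
  invariant : ∀ m : ι, ∀ᵐ x ∂p, D m x A = A.indicator 1 x

/-- The usual notion of ergodicity: `p` is an invariant measure which takes only the values
`0` and `1` on the almost surely invariant sets. -/
structure IsErgodicState (D : ι → Kernel α α) (p : Measure α) : Prop where
  invariant : ∀ m : ι, D m ∘ₘ p = p
  zero_or_one : ∀ A : Set α, IsASInvariantSet D p A → p A = 0 ∨ p A = 1

/-- The invariant σ-algebra, consisting of the `p`-almost surely invariant sets. -/
@[reducible] def invariantSigma (D : ι → Kernel α α) [∀ m, IsMarkovKernel (D m)] (p : Measure α) :
    MeasurableSpace α where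
  MeasurableSet' A := IsASInvariantSet D p A
  measurableSet_empty := ⟨MeasurableSet.empty, fun m => by simp⟩
  measurableSet_compl A hA := ⟨hA.measurableSet.compl, fun m => by
    filter_upwards [hA.invariant m] with x hx
    rw [prob_compl_eq_one_sub hA.measurableSet, hx]
    by_cases h : x ∈ A <;> simp [h]⟩
  measurableSet_iUnion A hA := ⟨MeasurableSet.iUnion fun i => (hA i).measurableSet, fun m => by
    have h : ∀ᵐ x ∂p, ∀ i, D m x (A i) = (A i).indicator 1 x :=
      ae_all_iff.2 fun i => (hA i).invariant m
    filter_upwards [h] with x hx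
    by_cases hxA : x ∈ ⋃ i, A i
    · rw [Set.indicator_of_mem hxA]
      obtain ⟨i, hi⟩ := Set.mem_iUnion.1 hxA
      refine le_antisymm prob_le_one ?_
      calc (1 : α → ENNReal) x = D m x (A i) := by rw [hx i, Set.indicator_of_mem hi]
        _ ≤ D m x (⋃ i, A i) := measure_mono (Set.subset_iUnion A i)
    · rw [Set.indicator_of_notMem hxA]
      refine measure_iUnion_null fun i => ?_
      rw [hx i, Set.indicator_of_notMem fun hi => hxA (Set.mem_iUnion.2 ⟨i, hi⟩)]⟩

/-- The set `α` equipped with the invariant σ-algebra. -/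
def InvSpace (D : ι → Kernel α α) [∀ m, IsMarkovKernel (D m)] (_p : Measure α) : Type u := α

instance (D : ι → Kernel α α) [∀ m, IsMarkovKernel (D m)] (p : Measure α) :
    MeasurableSpace (InvSpace D p) := invariantSigma (α := α) D p

/-- The identity map from `α` to `α` with the invariant σ-algebra. -/
def InvSpace.of (D : ι → Kernel α α) [∀ m, IsMarkovKernel (D m)] (p : Measure α) :
    α → InvSpace D p := fun x => x

lemma InvSpace.measurable_of (D : ι → Kernel α α) [∀ m, IsMarkovKernel (D m)] (p : Measure α) :
    Measurable (InvSpace.of D p) :=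
  fun A hA => (show IsASInvariantSet D p A from hA).measurableSet

/-- The kernel `r` from `α` to `α` with the invariant σ-algebra induced by the identity map. -/
def invProj (D : ι → Kernel α α) [∀ m, IsMarkovKernel (D m)] (p : Measure α) :
    Kernel α (InvSpace D p) :=
  Kernel.deterministic (InvSpace.of D p) (InvSpace.measurable_of D p)

/-- The state `p_inv = r p`, i.e. the restriction of `p` to the invariant σ-algebra. -/
def invState (D : ι → Kernel α α) [∀ m, IsMarkovKernel (D m)] (p : Measure α) :
    Measure (InvSpace D p) :=
  invProj D p ∘ₘ p

/-- `r : (α, p) → (ζ, pinv)` exhibits the standard Borel probability space `(ζ, pinv)` as an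
invariant object, i.e. as a colimit of the system `D` among standard Borel probability spaces and
measure-preserving Markov kernels up to almost sure equality, such that the correspondence between
invariant morphisms and their factorizations preserves and reflects almost sure determinism. -/
structure IsInvariantObject (D : ι → Kernel α α) (p : Measure α)
    {ζ : Type u} [MeasurableSpace ζ] [StandardBorelSpace ζ] (pinv : Measure ζ)
    (r : Kernel α ζ) : Prop where
  isMorphism : IsMorphism p pinv r
  invariant : ASInvariant D p r
  exists_factor : ∀ (β : Type u) [MeasurableSpace β] [StandardBorelSpace β] (q : Measure β)
    (f : Kernel α β), IsMorphism p q f → ASInvariant D p f →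
      ∃ g : Kernel ζ β, IsMorphism pinv q g ∧ ASEq p (g ∘ₖ r) f
  unique_factor : ∀ (β : Type u) [MeasurableSpace β] [StandardBorelSpace β] (q : Measure β)
    (g g' : Kernel ζ β), IsMorphism pinv q g → IsMorphism pinv q g' →
      ASEq p (g ∘ₖ r) (g' ∘ₖ r) → ASEq pinv g g'
  deterministic_iff : ∀ (β : Type u) [MeasurableSpace β] [StandardBorelSpace β] (q : Measure β)
    (f : Kernel α β) (g : Kernel ζ β), IsMorphism p q f → ASInvariant D p f →
      IsMorphism pinv q g → ASEq p (g ∘ₖ r) f → (ASDeterministic p f ↔ ASDeterministic pinv g)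

end Invariance

/-! Finite permutations acting on sequences -/

section Permutations

/-- Permutations of `ℕ` moving only finitely many elements. -/
def FinPerm : Type := {σ : Equiv.Perm ℕ // {i | σ i ≠ i}.Finite}

variable (X : Type u) [MeasurableSpace X]

/-- The action of finite permutations on sequences by permuting the components. -/
def permKernel (σ : FinPerm) : Kernel (ℕ → X) (ℕ → X) :=
  Kernel.deterministic (fun x i => x (σ.1 i))
    (measurable_pi_lambda _ fun i => measurable_pi_apply (σ.1 i))

instance (σ : FinPerm) : IsMarkovKernel (permKernel X σ) := by
  unfold permKernel; infer_instance

variable {X}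

/-- `p` is invariant under all finite permutations. -/
def Exchangeable (p : Measure (ℕ → X)) : Prop :=
  ∀ σ : FinPerm, permKernel X σ ∘ₘ p = p

variable (X)

/-- The kernel sending a measure `q` to the constant sequence `(q, q, …)`. -/
def copyNat : Kernel (ProbabilityMeasure X) (ℕ → ProbabilityMeasure X) :=
  Kernel.deterministic (fun q _ => q) (measurable_pi_lambda _ fun _ => measurable_id)

lemma measurable_infinitePi_probabilityMeasure :
    Measurable fun q : ℕ → ProbabilityMeasure X =>
      Measure.infinitePi fun i => (q i : Measure X) := by
  refine Measurable.measure_of_isPiSystem_of_isProbabilityMeasure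
    generateFrom_squareCylinders.symm
    (isPiSystem_squareCylinders (fun _ => MeasurableSpace.isPiSystem_measurableSet) (by simp)) ?_
  rintro A ⟨s, t, ht, rfl⟩
  have h : ∀ i, MeasurableSet (t i) := fun i => ht i (Set.mem_univ i)
  simp_rw [Measure.infinitePi_pi (fun i : ℕ => (_ : Measure X)) (fun i _ => h i)]
  refine Finset.measurable_fun_prod s fun i _ => ?_
  exact (Measure.measurable_coe (h i)).comp (measurable_subtype_coe.comp (measurable_pi_apply i))

/-- The kernel sending a sequence of measures `(q₀, q₁, …)` to the law of a sequence of
independent samples from them. -/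
def sampNat : Kernel (ℕ → ProbabilityMeasure X) (ℕ → X) where
  toFun q := Measure.infinitePi fun i => (q i : Measure X)
  measurable' := measurable_infinitePi_probabilityMeasure X

variable {X}

/-- `μ` is a de Finetti measure of `p`: the mixture over `q ~ μ` of the laws of i.i.d. sequences
with common law `q` is `p`. -/
structure IsDeFinettiMeasure (p : Measure (ℕ → X)) (μ : Measure (ProbabilityMeasure X)) :
    Prop where
  isProbabilityMeasure : IsProbabilityMeasure μ
  mixture : (sampNat X ∘ₖ copyNat X) ∘ₘ μ = p

end Permutations

end

/-! Two facts about an i.i.d. law `iidLaw q` drive everything. By the strong law of large numbers,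
the limiting empirical measure of a sample is almost surely `q` (`empirical_ae_eq`); by the
Hewitt–Savage law, permutation-invariant functions are almost surely constant
(`iidLaw_ae_eq_const`). Mixing over `q`, the first fact forces every de Finetti measure to be the
law of the empirical measure under `p`, hence uniqueness. Together they show that an invariant
kernel depends on a sequence only through its empirical measure, so `ProbabilityMeasure X` with the
de Finetti measure is an invariant object (`IsDeFinettiMeasure.isInvariantObject`).

Existence of the mixture comes from the predictive law of one component given infinitely many
others. Enlarging an infinite set of conditioning components does not change it, so the even
components are conditionally i.i.d. given the odd ones (`Exchangeable.lintegral_prod_even`).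

For the equivalences, determinism is read as a zero-one property (`asDeterministic_iff`). Ergodicity
makes the empirical measure deterministic, hence constant, so `p` is i.i.d.; Hewitt–Savage gives the
converse. An arbitrary invariant object enters only through its universal property. -/

/-! ### The space of probability measures on a standard Borel space -/

section ProbabilityMeasures

open Filter Topology

variable (X : Type u) [MeasurableSpace X] [StandardBorelSpace X]

/-- The rational points of the cumulative distribution function of `q`, where `X` is seen as a
subset of the real line. -/
noncomputable def ratCDF (q : ProbabilityMeasure X) (t : ℚ) : ℝ :=
  (q : Measure X).real (embeddingReal X ⁻¹' Set.Iic (t : ℝ))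

lemma measurable_ratCDF : Measurable (ratCDF X) := by
  refine measurable_pi_lambda _ fun t => Measurable.ennreal_toReal ?_
  exact (Measure.measurable_coe (measurable_embeddingReal X measurableSet_Iic)).comp
    measurable_subtype_coe

lemma ratCDF_eq_cdf (q : ProbabilityMeasure X) (t : ℚ) :
    ratCDF X q t = cdf ((q : Measure X).map (embeddingReal X)) t := by
  have := Measure.isProbabilityMeasure_map (μ := (q : Measure X))
    (measurable_embeddingReal X).aemeasurable
  rw [cdf_eq_real, ratCDF, map_measureReal_apply (measurable_embeddingReal X) measurableSet_Iic]

lemma isRatStieltjesPoint_ratCDF (q : ProbabilityMeasure X) :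
    IsRatStieltjesPoint (fun z : ℚ → ℝ => z) (ratCDF X q) := by
  have h : ratCDF X q = fun t : ℚ => cdf ((q : Measure X).map (embeddingReal X)) t :=
    funext (ratCDF_eq_cdf X q)
  rw [h]
  refine ⟨fun s t hst => monotone_cdf _ (by exact_mod_cast hst),
    (tendsto_cdf_atTop _).comp (tendsto_ratCast_atTop_iff.2 tendsto_id),
    (tendsto_cdf_atBot _).comp (tendsto_ratCast_atBot_iff.2 tendsto_id), fun t => ?_⟩
  refine Eq.trans ?_ (StieltjesFunction.iInf_rat_gt_eq _ (t : ℝ))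
  exact Equiv.iInf_congr ⟨fun s => ⟨s.1, Rat.cast_lt.2 s.2⟩,
    fun s => ⟨s.1, Rat.cast_lt.1 s.2⟩, fun _ => rfl, fun _ => rfl⟩ fun _ => rfl

/-- The probability measure on the real line with prescribed rational points of its cumulative
distribution function, if there is one. -/
noncomputable def realMeasureOfRat (z : ℚ → ℝ) : Measure ℝ :=
  (stieltjesOfMeasurableRat (fun z : ℚ → ℝ => z) measurable_id z).measure

lemma measurable_realMeasureOfRat : Measurable realMeasureOfRat :=
  measurable_measure_stieltjesOfMeasurableRat measurable_id

/-- By right continuity, a distribution function is determined by its values at the rationals. -/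
lemma realMeasureOfRat_ratCDF (q : ProbabilityMeasure X) :
    realMeasureOfRat (ratCDF X q) = (q : Measure X).map (embeddingReal X) := by
  have := Measure.isProbabilityMeasure_map (μ := (q : Measure X))
    (measurable_embeddingReal X).aemeasurable
  rw [← measure_cdf ((q : Measure X).map (embeddingReal X)), realMeasureOfRat]
  congr 1
  ext x
  rw [← StieltjesFunction.iInf_rat_gt_eq, ← StieltjesFunction.iInf_rat_gt_eq]
  congr 1
  ext r
  rw [stieltjesOfMeasurableRat_eq, toRatCDF_of_isRatStieltjesPoint (isRatStieltjesPoint_ratCDF X q),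
    ratCDF_eq_cdf]

open scoped Classical in
/-- A measurable left inverse of `ratCDF`. -/
noncomputable def ofRatCDF [Nonempty X] (z : ℚ → ℝ) : ProbabilityMeasure X :=
  -- The test only secures total mass one; on the range of `ratCDF` it always succeeds.
  ⟨if (realMeasureOfRat z).comap (embeddingReal X) Set.univ = 1 then
      (realMeasureOfRat z).comap (embeddingReal X)
    else Measure.dirac (Classical.arbitrary X), by
      split_ifs with h
      · exact ⟨h⟩
      · infer_instance⟩

lemma measurable_ofRatCDF [Nonempty X] : Measurable (ofRatCDF X) := by
  have h : Measurable fun z => (realMeasureOfRat z).comap (embeddingReal X) := by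
    refine Measure.measurable_of_measurable_coe _ fun s hs => ?_
    simp_rw [(measurableEmbedding_embeddingReal X).comap_apply]
    exact (Measure.measurable_coe
      ((measurableEmbedding_embeddingReal X).measurableSet_image.2 hs)).comp
      measurable_realMeasureOfRat
  classical
  refine Measurable.subtype_mk (Measurable.ite ?_ h measurable_const)
  exact ((Measure.measurable_coe MeasurableSet.univ).comp h) (measurableSet_singleton 1)

lemma ofRatCDF_ratCDF [Nonempty X] (q : ProbabilityMeasure X) : ofRatCDF X (ratCDF X q) = q := by
  apply Subtype.ext
  rw [ofRatCDF]
  simp only [realMeasureOfRat_ratCDF, (measurableEmbedding_embeddingReal X).comap_map]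
  exact if_pos measure_univ

/-- The range is measurable because it is the fixed-point set of `ratCDF X ∘ ofRatCDF X`. -/
lemma measurableEmbedding_ratCDF [Nonempty X] : MeasurableEmbedding (ratCDF X) := by
  refine MeasurableEmbedding.of_measurable_inverse (measurable_ratCDF X) ?_
    (measurable_ofRatCDF X) (ofRatCDF_ratCDF X)
  have h : Set.range (ratCDF X) = {z | ratCDF X (ofRatCDF X z) = z} := by
    ext z
    refine ⟨?_, fun h => ⟨_, h⟩⟩
    rintro ⟨q, rfl⟩
    exact congrArg _ (ofRatCDF_ratCDF X q)
  rw [h]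
  exact measurableSet_eq_fun ((measurable_ratCDF X).comp (measurable_ofRatCDF X)) measurable_id

lemma standardBorelSpace_of_measurableEmbedding {α β : Type*} [MeasurableSpace α]
    [MeasurableSpace β] [StandardBorelSpace β] {f : α → β} (hf : MeasurableEmbedding f) :
    StandardBorelSpace α := by
  have := hf.measurableSet_range.standardBorel
  let := upgradeStandardBorel (Set.range f)
  let e := hf.equivRange
  let : TopologicalSpace α := .induced e.toEquiv inferInstance
  refine ⟨inferInstance, ⟨?_⟩, e.toEquiv.polishSpace_induced⟩
  rw [borel_comap, ← eq_borel_upgradeStandardBorel (Set.range f)]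
  exact e.measurableEmbedding.comap_eq.symm

/-- Needed for the space of measures to qualify as an invariant object, and for deterministic states
on it to be Dirac. -/
instance standardBorelSpace_probabilityMeasure [Nonempty X] :
    StandardBorelSpace (ProbabilityMeasure X) :=
  standardBorelSpace_of_measurableEmbedding (measurableEmbedding_ratCDF X)

/-! ### The empirical measure of a sequence -/

variable {X}

/-- The limiting frequency of the values in the lower set with upper bound `t`. -/
noncomputable def limFreq (x : ℕ → X) (t : ℚ) : ℝ :=
  -- A limsup, unlike a limit, is defined and measurable without any convergence assumption.
  limsup (fun n : ℕ => (∑ i ∈ Finset.range n,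
    (embeddingReal X ⁻¹' Set.Iic (t : ℝ)).indicator (1 : X → ℝ) (x i)) / n) atTop

lemma measurable_limFreq : Measurable (limFreq (X := X)) := by
  refine measurable_pi_lambda _ fun t => Measurable.limsup fun n => ?_
  refine (Finset.measurable_sum _ fun i _ => ?_).div_const _
  exact (measurable_one.indicator (measurable_embeddingReal X measurableSet_Iic)).comp
    (measurable_pi_apply i)

variable (X) in
/-- The limiting empirical measure of a sequence. -/
noncomputable def empirical [Nonempty X] (x : ℕ → X) : ProbabilityMeasure X :=
  ofRatCDF X (limFreq x)

lemma measurable_empirical [Nonempty X] : Measurable (empirical X) :=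
  (measurable_ofRatCDF X).comp measurable_limFreq

/-- The law of an i.i.d. sequence. -/
noncomputable abbrev iidLaw {X : Type u} [MeasurableSpace X] (q : ProbabilityMeasure X) :
    Measure (ℕ → X) :=
  Measure.infinitePi fun _ : ℕ => (q : Measure X)

/-- The strong law applies to the indicators of countably many half-lines simultaneously, and these
determine `q`. -/
lemma empirical_ae_eq [Nonempty X] (q : ProbabilityMeasure X) :
    ∀ᵐ x ∂iidLaw q, empirical X x = q := by
  have h : ∀ᵐ x ∂iidLaw q, ∀ t : ℚ, limFreq x t = ratCDF X q t := by
    refine ae_all_iff.2 fun t => ?_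
    set B := embeddingReal X ⁻¹' Set.Iic (t : ℝ)
    have hBm : MeasurableSet B := measurable_embeddingReal X measurableSet_Iic
    have hm : Measurable (B.indicator (1 : X → ℝ)) := measurable_one.indicator hBm
    have hlaw : ∀ i : ℕ, (iidLaw q).map (fun x => x i) = (q : Measure X) :=
      fun i => Measure.infinitePi_map_eval _ i
    have hid : ∀ i, IdentDistrib (fun x : ℕ → X => B.indicator (1 : X → ℝ) (x i))
        (fun x => B.indicator (1 : X → ℝ) (x 0)) (iidLaw q) (iidLaw q) := fun i =>
      (IdentDistrib.mk (measurable_pi_apply i).aemeasurable (measurable_pi_apply 0).aemeasurable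
        ((hlaw i).trans (hlaw 0).symm)).comp hm
    have hint : Integrable (fun x : ℕ → X => B.indicator (1 : X → ℝ) (x 0)) (iidLaw q) := by
      refine Integrable.of_bound (hm.comp (measurable_pi_apply 0)).aestronglyMeasurable 1
        (ae_of_all _ fun x => ?_)
      by_cases hx : x 0 ∈ B <;> simp [hx]
    have hind : iIndepFun (fun (i : ℕ) (x : ℕ → X) => B.indicator (1 : X → ℝ) (x i)) (iidLaw q) :=
      iIndepFun_infinitePi fun _ => hm
    have hexp : ∫ x, B.indicator (1 : X → ℝ) (x 0) ∂iidLaw q = ratCDF X q t := by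
      rw [← integral_map (φ := fun x : ℕ → X => x 0) (measurable_pi_apply 0).aemeasurable
        hm.aestronglyMeasurable, hlaw, integral_indicator_one hBm, ratCDF]
    have := strong_law_ae_real (fun (i : ℕ) (x : ℕ → X) => B.indicator (1 : X → ℝ) (x i)) hint
      (fun i j hij => hind.indepFun hij) hid
    filter_upwards [this] with x hx
    rw [← hexp]
    exact hx.limsup_eq
  filter_upwards [h] with x hx
  rw [empirical, funext hx, ofRatCDF_ratCDF]

end ProbabilityMeasures

/-! ### The Hewitt–Savage zero-one law for i.i.d. sequences -/

section HewittSavage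

variable {X : Type u} [MeasurableSpace X]

/-- Select the components of a sequence with the indices `k 0`, `k 1`, … -/
def reindex (k : ℕ → ℕ) (x : ℕ → X) : ℕ → X := fun i => x (k i)

lemma measurable_reindex (k : ℕ → ℕ) : Measurable (reindex (X := X) k) :=
  measurable_pi_lambda _ fun i => measurable_pi_apply (k i)

lemma permKernel_eq (σ : FinPerm) :
    permKernel X σ = Kernel.deterministic (reindex σ.1) (measurable_reindex _) := rfl

/-- Every injection of `ℕ` agrees with some finite permutation on a given initial segment. -/
lemma exists_finPerm_eq {k : ℕ → ℕ} (hk : k.Injective) (n : ℕ) :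
    ∃ σ : FinPerm, ∀ i < n, σ.1 i = k i := by
  induction n with
  | zero => exact ⟨⟨1, by simp⟩, by simp⟩
  | succ n ih =>
    obtain ⟨σ, hσ⟩ := ih
    -- The transposition corrects the value at `n`; injectivity of `k` and `σ` keeps it away from
    -- the earlier values.
    refine ⟨⟨Equiv.swap (σ.1 n) (k n) * σ.1, ?_⟩, fun i hi => ?_⟩
    · refine (σ.2.union (Set.toFinite {σ.1 n, k n})).subset fun i hi => ?_
      by_contra h
      simp only [Set.mem_union, Set.mem_ofPred_eq, not_or, not_not, Set.mem_insert_iff,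
        Set.mem_singleton_iff] at h
      apply hi
      rw [Equiv.Perm.mul_apply, h.1, Equiv.swap_apply_of_ne_of_ne h.2.1 h.2.2]
    · change Equiv.swap (σ.1 n) (k n) (σ.1 i) = k i
      rcases Nat.lt_succ_iff_lt_or_eq.1 hi with h | rfl
      · rw [hσ i h, Equiv.swap_apply_of_ne_of_ne _ (hk.ne h.ne)]
        rw [← hσ i h]
        exact σ.1.injective.ne h.ne
      · exact Equiv.swap_apply_left _ _

lemma iidLaw_map_reindex (q : ProbabilityMeasure X) {k : ℕ → ℕ} (hk : k.Injective) :
    (iidLaw q).map (reindex k) = iidLaw q := by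
  have h : iIndepFun (fun (i : ℕ) (x : ℕ → X) => x i) (iidLaw q) :=
    iIndepFun_infinitePi (X := fun _ : ℕ => (id : X → X)) fun _ => measurable_id
  have h' := (iIndepFun_iff_map_fun_eq_infinitePi_map
    (fun i => measurable_pi_apply (k i))).1 (h.precomp hk)
  simp_rw [Measure.infinitePi_map_eval] at h'
  exact h'

lemma measurePreserving_reindex (q : ProbabilityMeasure X) {k : ℕ → ℕ} (hk : k.Injective) :
    MeasurePreserving (reindex k) (iidLaw q) (iidLaw q) :=
  ⟨measurable_reindex k, iidLaw_map_reindex q hk⟩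

/-- Cylinder sets become independent of their images under a shift by a large number. -/
lemma exists_iidLaw_inter_reindex (q : ProbabilityMeasure X) {t : Set (ℕ → X)}
    (ht : t ∈ measurableCylinders fun _ : ℕ => X) :
    ∃ σ : FinPerm, (iidLaw q).real (t ∩ reindex σ.1 ⁻¹' t) = (iidLaw q).real t ^ 2 := by
  obtain ⟨s, S, hS, rfl⟩ := (mem_measurableCylinders _).1 ht
  obtain ⟨n, hn⟩ : ∃ n, ∀ i ∈ s, i < n := ⟨s.sup id + 1, fun i hi =>
    Nat.lt_succ_of_le (Finset.le_sup (f := id) hi)⟩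
  have hinj : Function.Injective fun i : ℕ => i + n := add_left_injective n
  -- On the indices in `s`, `σ` is the shift by `n`, so the permuted cylinder depends on coordinates
  -- disjoint from `s`.
  obtain ⟨σ, hσ⟩ := exists_finPerm_eq hinj n
  refine ⟨σ, ?_⟩
  have h : iIndepFun (fun (i : ℕ) (x : ℕ → X) => x i) (iidLaw q) :=
    iIndepFun_infinitePi (X := fun _ : ℕ => (id : X → X)) fun _ => measurable_id
  have hdisj : Disjoint s (s.image fun i => i + n) := by
    refine Finset.disjoint_left.2 fun i hi hi' => ?_
    obtain ⟨j, -, rfl⟩ := Finset.mem_image.1 hi'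
    have := hn _ hi
    omega
  have hI := h.indepFun_finset s (s.image fun i => i + n) hdisj fun i => measurable_pi_apply i
  let φ : ((s.image fun i => i + n : Finset ℕ) → X) → (s → X) :=
    fun y i => y ⟨i + n, Finset.mem_image_of_mem _ i.2⟩
  have hφ : Measurable φ := measurable_pi_lambda _ fun i => measurable_pi_apply _
  have hpre : reindex σ.1 ⁻¹' cylinder s S =
      (fun (x : ℕ → X) (i : (s.image fun i => i + n : Finset ℕ)) => x i) ⁻¹' (φ ⁻¹' S) := by
    ext x
    simp only [cylinder, Set.mem_preimage]
    congr! 1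
    ext i
    exact congrArg x (hσ i (hn i i.2))
  have hmeas : (iidLaw q) (reindex σ.1 ⁻¹' cylinder s S) = iidLaw q (cylinder s S) :=
    (measurePreserving_reindex q σ.1.injective).measure_preimage
      (MeasurableSet.cylinder s hS).nullMeasurableSet
  have := hI.measure_inter_preimage_eq_mul S (φ ⁻¹' S) hS (hφ hS)
  rw [← hpre, hmeas] at this
  simp only [Measure.real, sq, ← ENNReal.toReal_mul]
  exact congrArg _ this

/-- The Hewitt–Savage zero-one law. -/
theorem iidLaw_zero_or_one (q : ProbabilityMeasure X) {A : Set (ℕ → X)} (hA : MeasurableSet A)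
    (hinv : ∀ σ : FinPerm, reindex σ.1 ⁻¹' A =ᵐ[iidLaw q] A) :
    iidLaw q A = 0 ∨ iidLaw q A = 1 := by
  set P := iidLaw q
  -- Approximate `A` by a cylinder `t`. By invariance the permuted `t` is as close to `A`, so `P A`
  -- is near `P (t ∩ σ⁻¹t) = (P t)²`, which is near `(P A)²`; each approximation costs `2ε`.
  have key : ∀ ε : ℝ, 0 < ε → |P.real A - P.real A ^ 2| ≤ 4 * ε := by
    intro ε hε
    obtain ⟨t, ht, htA⟩ := (Measure.MeasureDense.of_generateFrom_isSetAlgebra_finite P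
      isSetAlgebra_measurableCylinders generateFrom_measurableCylinders.symm).approx A hA
      (measure_ne_top _ _) ε hε
    have htm : MeasurableSet t := MeasurableSet.of_mem_measurableCylinders ht
    obtain ⟨σ, hσ⟩ := exists_iidLaw_inter_reindex q ht
    have h1 : P.real (symmDiff A t) ≤ ε := ENNReal.toReal_le_of_le_ofReal hε.le htA.le
    have h2 : P.real (symmDiff A (reindex σ.1 ⁻¹' t)) ≤ ε := by
      have e : P (symmDiff A (reindex σ.1 ⁻¹' t)) = P (symmDiff A t) := by
        calc P (symmDiff A (reindex σ.1 ⁻¹' t))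
            = P (symmDiff (reindex σ.1 ⁻¹' A) (reindex σ.1 ⁻¹' t)) :=
              measure_congr ((hinv σ).symm.symmDiff Filter.EventuallyEq.rfl)
          _ = P (reindex σ.1 ⁻¹' (symmDiff A t)) := rfl
          _ = P (symmDiff A t) := (measurePreserving_reindex q σ.1.injective).measure_preimage
              (hA.symmDiff htm).nullMeasurableSet
      rwa [Measure.real, e]
    have hσt : MeasurableSet (reindex σ.1 ⁻¹' t) := measurable_reindex _ htm
    have h3 : |P.real A - P.real (t ∩ reindex σ.1 ⁻¹' t)| ≤ 2 * ε := by
      refine (abs_measureReal_sub_le_measureReal_symmDiff hA.nullMeasurableSet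
        (htm.inter hσt).nullMeasurableSet).trans ?_
      have hsub : symmDiff A (t ∩ reindex σ.1 ⁻¹' t) ⊆
          symmDiff A t ∪ symmDiff A (reindex σ.1 ⁻¹' t) := by
        intro x
        simp only [Set.mem_symmDiff, Set.mem_inter_iff, Set.mem_union]
        tauto
      have := (measureReal_mono (μ := P) hsub).trans (measureReal_union_le _ _)
      linarith
    have h4 : |P.real A - P.real t| ≤ ε :=
      (abs_measureReal_sub_le_measureReal_symmDiff hA.nullMeasurableSet
        htm.nullMeasurableSet).trans h1
    have h5 : |P.real A + P.real t| ≤ 2 := by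
      rw [abs_of_nonneg (by positivity)]
      linarith [measureReal_le_one (μ := P) (s := A), measureReal_le_one (μ := P) (s := t)]
    rw [hσ] at h3
    calc |P.real A - P.real A ^ 2|
        = |(P.real A - P.real t ^ 2) - (P.real A - P.real t) * (P.real A + P.real t)| := by ring_nf
      _ ≤ |P.real A - P.real t ^ 2| + |P.real A - P.real t| * |P.real A + P.real t| := by
        rw [← abs_mul]; exact abs_sub _ _
      _ ≤ 2 * ε + ε * 2 := by gcongr
      _ = 4 * ε := by ring
  have h0 : |P.real A - P.real A ^ 2| ≤ 0 :=
    le_of_forall_pos_le_add fun ε hε => by linarith [key (ε / 4) (by positivity)]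
  have h1 : P.real A * (1 - P.real A) = 0 := by
    linear_combination abs_nonpos_iff.1 h0
  rcases mul_eq_zero.1 h1 with h | h
  · exact Or.inl ((measureReal_eq_zero_iff).1 h)
  · refine Or.inr ((ENNReal.toReal_eq_one_iff _).1 ?_)
    change P.real A = 1
    linarith

/-- Functions that are invariant under finite permutations are almost surely constant. -/
theorem iidLaw_ae_eq_const (q : ProbabilityMeasure X) {g : (ℕ → X) → ENNReal} (hg : Measurable g)
    (hinv : ∀ σ : FinPerm, g ∘ reindex σ.1 =ᵐ[iidLaw q] g) :
    g =ᵐ[iidLaw q] fun _ => ∫⁻ x, g x ∂iidLaw q := by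
  obtain ⟨c, hc⟩ : ∃ c, g =ᵐ[iidLaw q] Function.const _ c := by
    refine Filter.exists_eventuallyEq_const_of_forall_separating MeasurableSet fun U hU => ?_
    have h := iidLaw_zero_or_one q (hg hU) fun σ => by
      filter_upwards [hinv σ] with x hx
      exact congrArg (· ∈ U) hx
    rcases h with h | h
    · exact Or.inr (measure_eq_zero_iff_ae_notMem.1 h)
    · exact Or.inl ((mem_ae_iff_prob_eq_one (hg hU)).2 h)
  have hint : ∫⁻ x, g x ∂iidLaw q = c := by
    rw [lintegral_congr_ae hc]
    simp
  rw [hint]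
  exact hc

end HewittSavage

/-! ### Existence of the de Finetti measure -/

section Mixtures

variable (X : Type u) [MeasurableSpace X]

/-- The kernel sending `q` to the law of an i.i.d. sequence with common law `q`. -/
noncomputable abbrev iidKernel : Kernel (ProbabilityMeasure X) (ℕ → X) := sampNat X ∘ₖ copyNat X

variable {X}

lemma iidKernel_apply (q : ProbabilityMeasure X) : iidKernel X q = iidLaw q := by
  rw [iidKernel, copyNat, Kernel.comp_deterministic_eq_comap]
  rfl

instance : IsMarkovKernel (iidKernel X) :=
  ⟨fun q => by rw [iidKernel_apply]; infer_instance⟩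

lemma ext_of_range_pi {P Q : Measure (ℕ → X)} [IsProbabilityMeasure P] [IsProbabilityMeasure Q]
    (h : ∀ (n : ℕ) (A : ℕ → Set X), (∀ i, MeasurableSet (A i)) →
      P ((Finset.range n : Set ℕ).pi A) = Q ((Finset.range n : Set ℕ).pi A)) : P = Q := by
  refine ext_of_generate_finite _ generateFrom_squareCylinders.symm
    (isPiSystem_squareCylinders (fun _ => MeasurableSpace.isPiSystem_measurableSet) (by simp)) ?_
    (by simp)
  rintro _ ⟨s, t, ht, rfl⟩
  classical
  -- Pad the missing coordinates with the whole space to reach an initial segment.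
  have e : (s : Set ℕ).pi t = (Finset.range (s.sup id + 1) : Set ℕ).pi
      fun i => if i ∈ s then t i else Set.univ := by
    ext x
    simp only [Set.mem_pi, Finset.mem_coe, Finset.mem_range]
    refine ⟨fun hx i _ => ?_, fun hx i hi => ?_⟩
    · split_ifs with hi
      · exact hx i hi
      · trivial
    · have := hx i (Nat.lt_succ_of_le (Finset.le_sup (f := id) hi))
      rwa [if_pos hi] at this
  rw [e]
  refine h _ _ fun i => ?_
  split_ifs
  · exact ht i (Set.mem_univ i)
  · exact MeasurableSet.univ

lemma Exchangeable.map_perm {p : Measure (ℕ → X)} (hp : Exchangeable p) (σ : FinPerm) :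
    p.map (reindex σ.1) = p := by
  have := hp σ
  rwa [permKernel_eq, Measure.deterministic_comp_eq_map] at this

/-- A box in the first `n` coordinates sees only an initial segment of `k`, where `k` agrees with a
finite permutation. -/
lemma Exchangeable.map_reindex {p : Measure (ℕ → X)} [IsProbabilityMeasure p]
    (hp : Exchangeable p) {k : ℕ → ℕ} (hk : k.Injective) : p.map (reindex k) = p := by
  have := Measure.isProbabilityMeasure_map (μ := p) (measurable_reindex (X := X) k).aemeasurable
  refine ext_of_range_pi fun n A hA => ?_
  have hm : MeasurableSet ((Finset.range n : Set ℕ).pi A) :=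
    MeasurableSet.pi (Finset.countable_toSet _) fun i _ => hA i
  obtain ⟨σ, hσ⟩ := exists_finPerm_eq hk n
  conv_rhs => rw [← hp.map_perm σ]
  rw [Measure.map_apply (measurable_reindex _) hm, Measure.map_apply (measurable_reindex _) hm]
  congr 1
  ext x
  simp only [Set.mem_preimage, Set.mem_pi, Finset.mem_coe, Finset.mem_range, reindex]
  exact forall₂_congr fun i hi => by rw [hσ i hi]

lemma Exchangeable.lintegral_reindex {p : Measure (ℕ → X)} [IsProbabilityMeasure p]
    (hp : Exchangeable p) {k : ℕ → ℕ} (hk : k.Injective) {h : (ℕ → X) → ENNReal}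
    (hh : Measurable h) : ∫⁻ x, h (reindex k x) ∂p = ∫⁻ x, h x ∂p := by
  conv_rhs => rw [← hp.map_reindex hk]
  rw [lintegral_map hh (measurable_reindex k)]

end Mixtures

section Existence

variable {X : Type u} [MeasurableSpace X] [StandardBorelSpace X] [Nonempty X]
  {p : Measure (ℕ → X)} [IsProbabilityMeasure p]

variable (p) in
/-- The conditional law of the first component given the others. -/
noncomputable def predictive : Kernel (ℕ → X) X :=
  condDistrib (fun x : ℕ → X => x 0) (reindex Nat.succ) p

instance : IsMarkovKernel (predictive p) := by
  unfold predictive; infer_instance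

/-- Prepending `j` to `k` gives an injection, so `(x j, reindex k x)` is distributed as the first
component and the remaining ones: `predictive p` is also the conditional law of `x j` given `reindex
k x`. -/
lemma Exchangeable.lintegral_indicator_mul (hp : Exchangeable p) {k : ℕ → ℕ} (hk : k.Injective)
    {j : ℕ} (hj : ∀ i, k i ≠ j) {A : Set X} (hA : MeasurableSet A) {h : (ℕ → X) → ENNReal}
    (hh : Measurable h) :
    ∫⁻ x, A.indicator 1 (x j) * h (reindex k x) ∂p =
      ∫⁻ x, predictive p (reindex k x) A * h (reindex k x) ∂p := by
  have hA1 : Measurable (A.indicator (1 : X → ENNReal)) := measurable_one.indicator hA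
  have hκ : Measurable fun w => predictive p w A := (predictive p).measurable_coe hA
  have hk' : Function.Injective fun n : ℕ => (Nat.casesOn n j k : ℕ) := by
    rintro (_ | a) (_ | b) hab
    · rfl
    · exact absurd hab.symm (hj b)
    · exact absurd hab (hj a)
    · exact congrArg _ (hk hab)
  have h1 : ∫⁻ x, A.indicator 1 (x j) * h (reindex k x) ∂p =
      ∫⁻ x, A.indicator 1 (x 0) * h (reindex Nat.succ x) ∂p :=
    hp.lintegral_reindex hk' (h := fun x => A.indicator 1 (x 0) * h (reindex Nat.succ x))
      ((hA1.comp (measurable_pi_apply 0)).mul (hh.comp (measurable_reindex _)))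
  have hF : Measurable fun z : (ℕ → X) × X => A.indicator (1 : X → ENNReal) z.2 * h z.1 :=
    (hA1.comp measurable_snd).mul (hh.comp measurable_fst)
  have hpair : Measurable fun x : ℕ → X => (reindex Nat.succ x, x 0) :=
    (measurable_reindex _).prodMk (measurable_pi_apply 0)
  have h2 : ∫⁻ x, A.indicator 1 (x 0) * h (reindex Nat.succ x) ∂p =
      ∫⁻ z, A.indicator 1 z.2 * h z.1 ∂(p.map (reindex Nat.succ) ⊗ₘ predictive p) := by
    rw [predictive, compProd_map_condDistrib (measurable_pi_apply 0).aemeasurable,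
      lintegral_map hF hpair]
  rw [h1, h2, Measure.lintegral_compProd hF, hp.map_reindex Nat.succ_injective,
    hp.lintegral_reindex hk (h := fun w => predictive p w A * h w) (hκ.mul hh)]
  refine lintegral_congr fun w => ?_
  change ∫⁻ b, A.indicator 1 b * h w ∂predictive p w = _
  rw [lintegral_mul_const _ hA1, lintegral_indicator_one hA]

/-- Two functions with values in the unit interval are almost surely equal if their second moments
all coincide. -/
lemma ae_eq_of_lintegral_mul_eq {Ω : Type*} [MeasurableSpace Ω] {P : Measure Ω}
    [IsProbabilityMeasure P] {a b : Ω → ENNReal} (ha : Measurable a) (hb : Measurable b)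
    (ha1 : ∀ x, a x ≤ 1) (hb1 : ∀ x, b x ≤ 1) (hab : ∫⁻ x, a x * b x ∂P = ∫⁻ x, a x * a x ∂P)
    (hbb : ∫⁻ x, b x * b x ∂P = ∫⁻ x, a x * a x ∂P) : a =ᵐ[P] b := by
  have hfin : ∀ {c d : Ω → ENNReal}, (∀ x, c x ≤ 1) → (∀ x, d x ≤ 1) → ∀ x, c x * d x ≤ 1 :=
    fun hc hd x => mul_le_one' (hc x) (hd x)
  have hInt : ∀ {c : Ω → ENNReal}, Measurable c → (∀ x, c x ≤ 1) →
      Integrable (fun x => (c x).toReal) P := fun hc hc1 =>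
    Integrable.of_bound hc.ennreal_toReal.aestronglyMeasurable 1 (ae_of_all _ fun x => by
      rw [Real.norm_of_nonneg ENNReal.toReal_nonneg]
      exact ENNReal.toReal_le_of_le_ofReal zero_le_one (by simpa using hc1 x))
  have hI : ∀ {c : Ω → ENNReal}, Measurable c → (∀ x, c x ≤ 1) →
      ∫ x, (c x).toReal ∂P = (∫⁻ x, c x ∂P).toReal := fun hc hc1 =>
    integral_toReal hc.aemeasurable (ae_of_all _ fun x => (hc1 x).trans_lt ENNReal.one_lt_top)
  have e : ∀ x, ((a x).toReal - (b x).toReal) ^ 2 =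
      (a x * a x).toReal - 2 * (a x * b x).toReal + (b x * b x).toReal := fun x => by
    simp only [ENNReal.toReal_mul]
    ring
  have haa' : Integrable (fun x => (a x * a x).toReal) P := hInt (ha.mul ha) (hfin ha1 ha1)
  have hab' : Integrable (fun x => 2 * (a x * b x).toReal) P :=
    (hInt (ha.mul hb) (hfin ha1 hb1)).const_mul 2
  have hbb' : Integrable (fun x => (b x * b x).toReal) P := hInt (hb.mul hb) (hfin hb1 hb1)
  have hd : Integrable (fun x => (a x * a x).toReal - 2 * (a x * b x).toReal) P := haa'.sub hab'
  have haa : ∫ x, (a x * a x).toReal ∂P = (∫⁻ x, a x * a x ∂P).toReal :=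
    hI (ha.mul ha) (hfin ha1 ha1)
  have hab'' : ∫ x, (a x * b x).toReal ∂P = (∫⁻ x, a x * b x ∂P).toReal :=
    hI (ha.mul hb) (hfin ha1 hb1)
  have hbb'' : ∫ x, (b x * b x).toReal ∂P = (∫⁻ x, b x * b x ∂P).toReal :=
    hI (hb.mul hb) (hfin hb1 hb1)
  have h0 : ∫ x, ((a x).toReal - (b x).toReal) ^ 2 ∂P = 0 := by
    simp_rw [e]
    rw [integral_add hd hbb', integral_sub haa' hab',
      integral_const_mul, haa, hab'', hbb'', hab, hbb]
    ring
  rw [integral_eq_zero_iff_of_nonneg (fun x => sq_nonneg _)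
    (by simp_rw [e]; exact hd.add hbb')] at h0
  filter_upwards [h0] with x hx
  have hx' : (a x).toReal = (b x).toReal := sub_eq_zero.1 (pow_eq_zero_iff two_ne_zero |>.1 hx)
  exact (ENNReal.toReal_eq_toReal_iff' ((ha1 x).trans_lt ENNReal.one_lt_top).ne
    ((hb1 x).trans_lt ENNReal.one_lt_top).ne).1 hx'

/-- Conditioning on additional components does not change the predictive distribution. -/
lemma Exchangeable.predictive_ae_eq (hp : Exchangeable p) {k i : ℕ → ℕ} (hk : k.Injective)
    (hi : i.Injective) {j : ℕ} (hj : ∀ n, k n ≠ j) {A : Set X} (hA : MeasurableSet A) :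
    (fun x => predictive p (reindex (k ∘ i) x) A) =ᵐ[p] fun x => predictive p (reindex k x) A := by
  have hκ : Measurable fun w => predictive p w A := (predictive p).measurable_coe hA
  have hκκ : Measurable fun w => predictive p w A * predictive p w A := hκ.mul hκ
  refine ae_eq_of_lintegral_mul_eq (hκ.comp (measurable_reindex _)) (hκ.comp (measurable_reindex _))
    (fun _ => prob_le_one) (fun _ => prob_le_one) ?_ ?_
  · have h1 := hp.lintegral_indicator_mul hk hj hA
      (h := fun w => predictive p (reindex i w) A) (hκ.comp (measurable_reindex _))
    have h2 := hp.lintegral_indicator_mul (hk.comp hi) (fun n => hj (i n)) hA hκ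
    simp_rw [mul_comm (predictive p (reindex (k ∘ i) _) A) (predictive p (reindex k _) A)]
    exact h1.symm.trans h2
  · exact (hp.lintegral_reindex hk hκκ).trans (hp.lintegral_reindex (hk.comp hi) hκκ).symm

/-- The components with even index are conditionally i.i.d. given those with odd index. -/
lemma Exchangeable.lintegral_prod_even (hp : Exchangeable p) {A : ℕ → Set X}
    (hA : ∀ i, MeasurableSet (A i)) (n : ℕ) {h : (ℕ → X) → ENNReal} (hh : Measurable h) :
    ∫⁻ x, (∏ i ∈ Finset.range n, (A i).indicator 1 (x (2 * i))) *
        h (reindex (fun i => 2 * i + 1) x) ∂p =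
      ∫⁻ x, (∏ i ∈ Finset.range n, predictive p (reindex (fun i => 2 * i + 1) x) (A i)) *
        h (reindex (fun i => 2 * i + 1) x) ∂p := by
  induction n generalizing h with
  | zero => simp
  | succ n ih =>
    have hκ : Measurable fun w => predictive p w (A n) := (predictive p).measurable_coe (hA n)
    -- `k` lists the first `n` even indices, then all odd ones, and misses `2 * n`. Having
    -- integrated out component `2 * n`, `predictive_ae_eq` removes the even components from the
    -- conditioning.
    let k : ℕ → ℕ := fun i => if i < n then 2 * i else 2 * (i - n) + 1
    have hk : k.Injective := by
      intro a b hab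
      simp only [k] at hab
      split_ifs at hab <;> omega
    have hj : ∀ i, k i ≠ 2 * n := by
      intro i
      simp only [k]
      split_ifs <;> omega
    have hodd : k ∘ (fun i => i + n) = fun i => 2 * i + 1 := by
      ext i
      simp [k]
    let G : (ℕ → X) → ENNReal := fun w =>
      (∏ i ∈ Finset.range n, (A i).indicator 1 (w i)) * h (reindex (fun i => i + n) w)
    have hG : Measurable G := (Finset.measurable_fun_prod _ fun i _ =>
      (measurable_one.indicator (hA i)).comp (measurable_pi_apply i)).mul
      (hh.comp (measurable_reindex _))
    have hGk : ∀ x, G (reindex k x) = (∏ i ∈ Finset.range n, (A i).indicator 1 (x (2 * i))) *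
        h (reindex (fun i => 2 * i + 1) x) := by
      intro x
      have e : reindex (fun i => i + n) (reindex k x) = reindex (fun i => 2 * i + 1) x := by
        rw [← hodd]
        rfl
      simp only [G, e]
      congr 1
      refine Finset.prod_congr rfl fun i hi => ?_
      simp [reindex, k, Finset.mem_range.1 hi]
    calc _ = ∫⁻ x, (A n).indicator 1 (x (2 * n)) * G (reindex k x) ∂p := by
          refine lintegral_congr fun x => ?_
          rw [hGk, Finset.prod_range_succ]
          ring
      _ = ∫⁻ x, predictive p (reindex k x) (A n) * G (reindex k x) ∂p :=
          hp.lintegral_indicator_mul hk hj (hA n) hG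
      _ = ∫⁻ x, (∏ i ∈ Finset.range n, (A i).indicator 1 (x (2 * i))) *
            (predictive p (reindex (fun i => 2 * i + 1) x) (A n) *
              h (reindex (fun i => 2 * i + 1) x)) ∂p := by
          refine lintegral_congr_ae ?_
          filter_upwards [hp.predictive_ae_eq hk (add_left_injective n) hj (hA n)] with x hx
          rw [← hx, hGk, hodd]
          ring
      _ = _ := by
          rw [ih (h := fun w => predictive p w (A n) * h w) (hκ.mul hh)]
          refine lintegral_congr fun x => ?_
          rw [Finset.prod_range_succ]
          ring

/-- De Finetti's theorem: existence of a de Finetti measure. -/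
theorem Exchangeable.exists_isDeFinettiMeasure (hp : Exchangeable p) :
    ∃ μ : Measure (ProbabilityMeasure X), IsDeFinettiMeasure p μ := by
  -- The directing measure is the prediction from the odd components; the even components,
  -- conditionally i.i.d. with this law, are again distributed as `p`.
  let Φ : (ℕ → X) → ProbabilityMeasure X := fun x =>
    ⟨predictive p (reindex (fun i => 2 * i + 1) x), inferInstance⟩
  have hΦ : Measurable Φ :=
    ((predictive p).measurable.comp (measurable_reindex _)).subtype_mk
  have hμ : IsProbabilityMeasure (p.map Φ) := Measure.isProbabilityMeasure_map hΦ.aemeasurable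
  refine ⟨p.map Φ, hμ, ext_of_range_pi fun n A hA => ?_⟩
  have hm : MeasurableSet ((Finset.range n : Set ℕ).pi A) :=
    MeasurableSet.pi (Finset.countable_toSet _) fun i _ => hA i
  have heven : Function.Injective fun i : ℕ => 2 * i := fun a b hab => by
    simp only at hab; omega
  have h := hp.lintegral_prod_even hA n (h := 1) measurable_one
  simp only [Pi.one_apply, mul_one] at h
  rw [Measure.bind_apply hm (iidKernel X).aemeasurable,
    lintegral_map ((iidKernel X).measurable_coe hm) hΦ]
  simp_rw [iidKernel_apply, Measure.infinitePi_pi (fun _ : ℕ => (_ : Measure X)) fun i _ => hA i]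
  refine h.symm.trans ?_
  conv_rhs => rw [← hp.map_reindex heven, Measure.map_apply (measurable_reindex _) hm]
  rw [← lintegral_indicator_one (measurable_reindex _ hm)]
  refine lintegral_congr fun x => ?_
  by_cases hx : ∀ i < n, x (2 * i) ∈ A i
  · rw [Set.indicator_of_mem (by simpa [reindex] using hx)]
    exact Finset.prod_eq_one fun i hi => by simp [hx i (Finset.mem_range.1 hi)]
  · rw [Set.indicator_of_notMem (by simpa [reindex] using hx)]
    push Not at hx
    obtain ⟨i, hi, hxi⟩ := hx
    exact Finset.prod_eq_zero (Finset.mem_range.2 hi) (by simp [hxi])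

end Existence

/-! ### Deterministic kernels and states -/

section Deterministic

variable {α β : Type u} [MeasurableSpace α] [MeasurableSpace β]

lemma copy_comp_apply (q : Measure α) {C : Set (α × α)} (hC : MeasurableSet C) :
    (Kernel.copy α ∘ₘ q) C = q {y | (y, y) ∈ C} := by
  rw [Kernel.copy, Measure.deterministic_comp_eq_map]
  exact Measure.map_apply (measurable_id.prodMk measurable_id) hC

lemma asDeterministic_iff_forall_prod {p : Measure α} {f : Kernel α β} [IsMarkovKernel f] :
    ASDeterministic p f ↔ ∀ C : Set (β × β), MeasurableSet C →
      ∀ᵐ x ∂p, f x {y | (y, y) ∈ C} = ((f x).prod (f x)) C := by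
  refine forall₂_congr fun C hC => ?_
  have h : ∀ x, ((f ∥ₖ f) ∘ₖ Kernel.copy α) x = (f x).prod (f x) := fun x => by
    rw [Kernel.comp_apply, Kernel.copy_apply, Measure.dirac_bind (Kernel.measurable _),
      Kernel.parallelComp_apply]
  simp_rw [h, Kernel.comp_apply, copy_comp_apply _ hC]

lemma ENNReal.eq_zero_or_one_of_eq_mul_self {c : ENNReal} (hc : c ≤ 1) (h : c = c * c) :
    c = 0 ∨ c = 1 := by
  by_cases h0 : c = 0
  · exact Or.inl h0
  · right
    have hfin : c ≠ ⊤ := (hc.trans_lt ENNReal.one_lt_top).ne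
    exact ((ENNReal.mul_right_inj h0 hfin).1 ((mul_one c).trans h)).symm

/-- A kernel is almost surely deterministic if and only if its probabilities are almost surely zero
or one. -/
lemma asDeterministic_iff {p : Measure α} {f : Kernel α β} [IsMarkovKernel f] :
    ASDeterministic p f ↔ ∀ B : Set β, MeasurableSet B → ∀ᵐ x ∂p, f x B = 0 ∨ f x B = 1 := by
  rw [asDeterministic_iff_forall_prod]
  refine ⟨fun h B hB => ?_, fun h C hC => ?_⟩
  · filter_upwards [h _ (hB.prod hB)] with x hx
    rw [Measure.prod_prod] at hx
    have e : {y | (y, y) ∈ B ×ˢ B} = B := by ext y; simp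
    rw [e] at hx
    exact ENNReal.eq_zero_or_one_of_eq_mul_self prob_le_one hx
  -- The zero-one property settles rectangles; a π-λ induction, with countably many null sets, does
  -- the rest.
  · have hdiag : Measurable fun y : β => (y, y) := measurable_id.prodMk measurable_id
    induction C, hC using MeasurableSpace.induction_on_inter generateFrom_prod.symm isPiSystem_prod
      with
    | empty => simp
    | basic C hC =>
      obtain ⟨A, hA, B, hB, rfl⟩ := hC
      filter_upwards [h A hA, h B hB] with x hxA hxB
      rw [Measure.prod_prod]
      change f x (A ∩ B) = _
      rcases hxA with hxA | hxA
      · rw [hxA, zero_mul]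
        exact measure_mono_null Set.inter_subset_left hxA
      rcases hxB with hxB | hxB
      · rw [hxB, mul_zero]
        exact measure_mono_null Set.inter_subset_right hxB
      · rw [hxA, hxB, mul_one, ← mem_ae_iff_prob_eq_one (hA.inter hB)]
        exact Filter.inter_mem ((mem_ae_iff_prob_eq_one hA).2 hxA)
          ((mem_ae_iff_prob_eq_one hB).2 hxB)
    | compl C hC ih =>
      filter_upwards [ih] with x hx
      have e := prob_compl_eq_one_sub (μ := f x) (hdiag hC)
      rw [prob_compl_eq_one_sub hC, ← hx]
      exact e
    | iUnion C hd hC ih =>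
      filter_upwards [ae_all_iff.2 ih] with x hx
      rw [measure_iUnion hd hC]
      have e : {y | (y, y) ∈ ⋃ i, C i} = ⋃ i, {y | (y, y) ∈ C i} := by ext y; simp
      rw [e]
      exact (measure_iUnion (fun i j hij => (hd hij).preimage fun y : β => (y, y))
        fun i => hdiag (hC i)).trans (tsum_congr hx)

/-- A state is a kernel from a point, so the zero-one criterion for kernels transfers to states. -/
lemma asDeterministic_dirac_const_iff {q : Measure β} [IsProbabilityMeasure q] :
    ASDeterministic (Measure.dirac (PUnit.unit : PUnit.{u + 1})) (Kernel.const _ q) ↔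
      IsDeterministicState q := by
  rw [asDeterministic_iff_forall_prod]
  simp only [ae_dirac_eq, Kernel.const_apply]
  refine ⟨fun h => Measure.ext fun C hC => (copy_comp_apply q hC).trans (h C hC), fun h C hC => ?_⟩
  exact (copy_comp_apply q hC).symm.trans (congrArg (fun ν => ν C) h)

/-- A probability measure is deterministic if and only if it only takes the values zero and one. -/
lemma isDeterministicState_iff {q : Measure β} [IsProbabilityMeasure q] :
    IsDeterministicState q ↔ ∀ B : Set β, MeasurableSet B → q B = 0 ∨ q B = 1 := by
  rw [← asDeterministic_dirac_const_iff, asDeterministic_iff]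
  simp [ae_dirac_eq]

lemma asDeterministic_deterministic (p : Measure α) {f : α → β} (hf : Measurable f) :
    ASDeterministic p (Kernel.deterministic f hf) := by
  refine asDeterministic_iff.2 fun B hB => ae_of_all _ fun x => ?_
  rw [Kernel.deterministic_apply' hf x hB]
  by_cases h : f x ∈ B <;> simp [h]

/-- The image of a deterministic state under an almost surely deterministic kernel is
deterministic. -/
lemma ASDeterministic.isDeterministicState_comp {p : Measure α} [IsProbabilityMeasure p]
    {f : Kernel α β} [IsMarkovKernel f] (hf : ASDeterministic p f)
    (h : ∀ B, MeasurableSet B → p {x | f x B = 1} = 0 ∨ p {x | f x B = 1} = 1) :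
    IsDeterministicState (f ∘ₘ p) := by
  refine isDeterministicState_iff.2 fun B hB => ?_
  have hm : MeasurableSet {x | f x B = 1} := f.measurable_coe hB (measurableSet_singleton 1)
  -- Almost surely `f x B` is the indicator of its own level set at one, so zero-one behaviour of
  -- `p` is needed on such sets only.
  have e : (f ∘ₘ p) B = p {x | f x B = 1} := by
    rw [Measure.bind_apply hB f.aemeasurable, ← lintegral_indicator_one hm]
    refine lintegral_congr_ae ?_
    filter_upwards [asDeterministic_iff.1 hf B hB] with x hx
    rcases hx with hx | hx <;> simp [hx]
  rw [e]
  exact h B hB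

/-- Zero-one values on a countable separating family make the identity almost surely constant. -/
lemma IsDeterministicState.exists_eq_dirac [StandardBorelSpace β] {q : Measure β}
    [IsProbabilityMeasure q] (h : IsDeterministicState q) : ∃ b, q = Measure.dirac b := by
  have : Nonempty β := q.nonempty_of_neZero
  obtain ⟨b, hb⟩ : ∃ b, id =ᵐ[q] Function.const _ b := by
    refine Filter.exists_eventuallyEq_const_of_forall_separating MeasurableSet fun U hU => ?_
    rcases isDeterministicState_iff.1 h U hU with h | h
    · exact Or.inr (measure_eq_zero_iff_ae_notMem.1 h)
    · exact Or.inl ((mem_ae_iff_prob_eq_one hU).2 h)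
  refine ⟨b, ?_⟩
  rw [← q.map_id, Measure.map_congr hb]
  exact (Measure.map_const q b).trans (by simp)

end Deterministic

/-! ### Invariance under finite permutations -/

section Invariance

variable {X : Type u} [MeasurableSpace X] {p : Measure (ℕ → X)}

lemma isASInvariantSet_iff {A : Set (ℕ → X)} : IsASInvariantSet (permKernel X) p A ↔
    MeasurableSet A ∧ ∀ σ : FinPerm, reindex σ.1 ⁻¹' A =ᵐ[p] A := by
  have key : MeasurableSet A → ∀ (σ : FinPerm) (x : ℕ → X),
      permKernel X σ x A = A.indicator 1 x ↔ (reindex σ.1 ⁻¹' A) x = A x := by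
    intro hA σ x
    rw [permKernel_eq, Kernel.deterministic_apply' _ _ hA]
    change _ ↔ (reindex σ.1 x ∈ A) = (x ∈ A)
    by_cases h1 : reindex σ.1 x ∈ A <;> by_cases h2 : x ∈ A <;> simp [h1, h2]
  exact ⟨fun h => ⟨h.1, fun σ => (h.2 σ).mono fun x => (key h.1 σ x).1⟩,
    fun h => ⟨h.1, fun σ => (h.2 σ).mono fun x => (key h.1 σ x).2⟩⟩

lemma asInvariant_iff {β : Type u} [MeasurableSpace β] {f : Kernel (ℕ → X) β} :
    ASInvariant (permKernel X) p f ↔ ∀ (σ : FinPerm) (B : Set β), MeasurableSet B →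
      ∀ᵐ x ∂p, f (reindex σ.1 x) B = f x B := by
  refine forall_congr' fun σ => forall₂_congr fun B hB => ?_
  simp_rw [permKernel_eq, Kernel.comp_deterministic_eq_comap, Kernel.comap_apply]

/-- Countability lets the exceptional null sets of all permutations be discarded together. The
displacement `σ i - i` is a finitely supported integer function determining `σ`. -/
instance : Countable FinPerm := by
  have hfin : ∀ σ : FinPerm, (Function.support fun i => (σ.1 i : ℤ) - i).Finite := fun σ =>
    σ.2.subset fun i hi h => hi (by simp [h])
  refine Function.Injective.countable (f := fun σ : FinPerm =>
    Finsupp.ofSupportFinite (fun i => (σ.1 i : ℤ) - i) (hfin σ)) fun σ τ h => ?_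
  refine Subtype.ext (Equiv.ext fun i => ?_)
  have := DFunLike.congr_fun h i
  simp only [Finsupp.ofSupportFinite_coe] at this
  omega

variable [StandardBorelSpace X] [Nonempty X] {μ : Measure (ProbabilityMeasure X)}

/-- Given `q`, the empirical measure is almost surely `q`. This yields uniqueness of the de Finetti
measure. -/
lemma IsDeFinettiMeasure.map_empirical (hμ : IsDeFinettiMeasure p μ) :
    p.map (empirical X) = μ := by
  ext B hB
  rw [Measure.map_apply measurable_empirical hB, ← hμ.mixture,
    Measure.bind_apply (measurable_empirical hB) (iidKernel X).aemeasurable,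
    ← lintegral_indicator_one hB]
  refine lintegral_congr fun q => ?_
  rw [iidKernel_apply]
  by_cases h : q ∈ B
  · rw [Set.indicator_of_mem h]
    refine (mem_ae_iff_prob_eq_one (measurable_empirical hB)).1 ?_
    filter_upwards [empirical_ae_eq q] with x hx
    rwa [Set.mem_preimage, hx]
  · rw [Set.indicator_of_notMem h]
    refine measure_eq_zero_iff_ae_notMem.2 ?_
    filter_upwards [empirical_ae_eq q] with x hx
    rwa [Set.mem_preimage, hx]

variable (X) in
/-- The kernel sending a sequence to its limiting empirical measure. -/
noncomputable abbrev empiricalKernel : Kernel (ℕ → X) (ProbabilityMeasure X) :=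
  Kernel.deterministic (empirical X) measurable_empirical

lemma IsDeFinettiMeasure.asInvariant_empirical (hμ : IsDeFinettiMeasure p μ) :
    ASInvariant (permKernel X) p (empiricalKernel X) := by
  refine asInvariant_iff.2 fun σ B hB => ?_
  have hm : MeasurableSet {x | empirical X (reindex σ.1 x) = empirical X x} :=
    measurableSet_eq_fun (measurable_empirical.comp (measurable_reindex _)) measurable_empirical
  have h : ∀ᵐ x ∂p, empirical X (reindex σ.1 x) = empirical X x := by
    rw [← hμ.mixture]
    refine Measure.ae_comp_of_ae_ae hm (ae_of_all _ fun q => ?_)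
    rw [iidKernel_apply]
    filter_upwards [empirical_ae_eq q, (measurePreserving_reindex q
      σ.1.injective).quasiMeasurePreserving.ae (empirical_ae_eq q)] with x h1 h2
    rw [h1, h2]
  filter_upwards [h] with x hx
  rw [Kernel.deterministic_apply, Kernel.deterministic_apply, hx]

/-- An invariant kernel factors through the limiting empirical measure. -/
lemma IsDeFinettiMeasure.asEq_comp_empirical (hμ : IsDeFinettiMeasure p μ) {β : Type u}
    [MeasurableSpace β] {f : Kernel (ℕ → X) β} (hf : ASInvariant (permKernel X) p f) :
    ASEq p ((f ∘ₖ iidKernel X) ∘ₖ empiricalKernel X) f := by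
  intro B hB
  have hfB : Measurable fun x => f x B := f.measurable_coe hB
  simp_rw [Kernel.comp_deterministic_eq_comap, Kernel.comap_apply]
  have hm : MeasurableSet {x | (f ∘ₖ iidKernel X) (empirical X x) B = f x B} :=
    measurableSet_eq_fun (((f ∘ₖ iidKernel X).measurable_coe hB).comp measurable_empirical) hfB
  -- Invariance modulo `p` descends to almost every i.i.d. component, where Hewitt–Savage replaces
  -- `f x B` by its mean.
  have hinv : ∀ᵐ q ∂μ, ∀ σ : FinPerm, ∀ᵐ x ∂iidLaw q, f (reindex σ.1 x) B = f x B := by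
    refine ae_all_iff.2 fun σ => ?_
    have h := asInvariant_iff.1 hf σ B hB
    rw [← hμ.mixture] at h
    filter_upwards [Measure.ae_ae_of_ae_comp h] with q hq
    rwa [iidKernel_apply] at hq
  rw [← hμ.mixture]
  refine Measure.ae_comp_of_ae_ae hm ?_
  filter_upwards [hinv] with q hq
  rw [iidKernel_apply]
  filter_upwards [empirical_ae_eq q, iidLaw_ae_eq_const q hfB hq] with x h1 h2
  rw [h1, h2, Kernel.comp_apply, Measure.bind_apply hB f.aemeasurable, iidKernel_apply]

/-- The limiting empirical measure is an invariant object. -/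
theorem IsDeFinettiMeasure.isInvariantObject (hμ : IsDeFinettiMeasure p μ) :
    IsInvariantObject (permKernel X) p μ (empiricalKernel X) := by
  have hmap := hμ.map_empirical
  -- As `μ` is the law of the empirical measure, almost sure statements pass in both directions;
  -- uniqueness and determinism of factors follow.
  have hpull : ∀ {P : ProbabilityMeasure X → Prop}, MeasurableSet {q | P q} →
      ((∀ᵐ x ∂p, P (empirical X x)) ↔ ∀ᵐ q ∂μ, P q) := fun hP => by
    rw [← hmap, ae_map_iff measurable_empirical.aemeasurable hP]
  refine ⟨⟨inferInstance, ?_⟩, hμ.asInvariant_empirical, ?_, ?_, ?_⟩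
  · rw [Measure.deterministic_comp_eq_map, hmap]
  · intro β _ _ q f hf hinv
    have := hf.isMarkovKernel
    refine ⟨f ∘ₖ iidKernel X, ⟨inferInstance, ?_⟩, hμ.asEq_comp_empirical hinv⟩
    rw [← Measure.comp_assoc, hμ.mixture, hf.preserves]
  · intro β _ _ q g g' _ _ h B hB
    have h := h B hB
    simp_rw [Kernel.comp_deterministic_eq_comap, Kernel.comap_apply] at h
    exact (hpull (measurableSet_eq_fun (g.measurable_coe hB) (g'.measurable_coe hB))).1 h
  · intro β _ _ q f g hf _ hg h
    have := hf.isMarkovKernel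
    have := hg.isMarkovKernel
    rw [asDeterministic_iff, asDeterministic_iff]
    refine forall₂_congr fun B hB => ?_
    have hgB : Measurable fun z => g z B := g.measurable_coe hB
    have h := h B hB
    simp_rw [Kernel.comp_deterministic_eq_comap, Kernel.comap_apply] at h
    rw [← hpull (P := fun z => g z B = 0 ∨ g z B = 1) ((hgB (measurableSet_singleton 0)).union
      (hgB (measurableSet_singleton 1)))]
    refine Filter.eventually_congr ?_
    filter_upwards [h] with x hx
    rw [hx]

end Invariance

/-! ### The equivalences -/

theorem mainTheorem9 {X : Type u} [MeasurableSpace X] [StandardBorelSpace X]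
    (p : Measure (ℕ → X)) [IsProbabilityMeasure p] (hp : Exchangeable p) :
    (∃! μ : Measure (ProbabilityMeasure X), IsDeFinettiMeasure p μ) ∧
    (∃ (Z : Type u) (_ : MeasurableSpace Z) (_ : StandardBorelSpace Z) (pinv : Measure Z)
      (r : Kernel (ℕ → X) Z), IsInvariantObject (permKernel X) p pinv r) ∧
    ∀ μ : Measure (ProbabilityMeasure X), IsDeFinettiMeasure p μ →
    ∀ (Z : Type u) [MeasurableSpace Z] [StandardBorelSpace Z] (pinv : Measure Z)
      (r : Kernel (ℕ → X) Z), IsInvariantObject (permKernel X) p pinv r →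
    List.TFAE [
      IsErgodicState (permKernel X) p,
      IsDeterministicState (invState (permKernel X) p),
      IsDeterministicState pinv,
      ∀ (Y : Type u) [MeasurableSpace Y] [StandardBorelSpace Y] (s : Kernel (ℕ → X) Y)
        [IsMarkovKernel s], ASDeterministic p s → ASInvariant (permKernel X) p s →
          IsDeterministicState (s ∘ₘ p),
      ∃ q : ProbabilityMeasure X, μ = Measure.dirac q,
      iIndepFun (fun (i : ℕ) (x : ℕ → X) => x i) p,
      ∃ q : ProbabilityMeasure X, p = Measure.infinitePi (fun _ : ℕ => (q : Measure X))] := by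
  have : Nonempty X := ⟨(p.nonempty_of_neZero).some 0⟩
  obtain ⟨μ₀, hμ₀⟩ := hp.exists_isDeFinettiMeasure
  refine ⟨⟨μ₀, hμ₀, fun μ hμ => hμ.map_empirical.symm.trans hμ₀.map_empirical⟩,
    ⟨_, _, inferInstance, _, _, hμ₀.isInvariantObject⟩, fun μ hμ Z _ _ pinv r hr => ?_⟩
  have hmarkov := hr.isMorphism.isMarkovKernel
  have hpinv : IsProbabilityMeasure pinv := by
    rw [← hr.isMorphism.preserves]
    infer_instance
  have hstate : invState (permKernel X) p = p.map (InvSpace.of (permKernel X) p) :=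
    Measure.deterministic_comp_eq_map _
  have hstateprob : IsProbabilityMeasure (invState (permKernel X) p) := by
    rw [hstate]
    exact Measure.isProbabilityMeasure_map (InvSpace.measurable_of _ _).aemeasurable
  tfae_have 1 → 2 := by
    intro h
    refine isDeterministicState_iff.2 fun A hA => ?_
    rw [hstate, Measure.map_apply (InvSpace.measurable_of _ _) hA]
    exact h.zero_or_one _ hA
  tfae_have 2 → 1 := by
    intro h
    refine ⟨hp, fun A hA => ?_⟩
    have hA' : MeasurableSet (α := InvSpace (permKernel X) p) A := hA
    have := isDeterministicState_iff.1 h A hA'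
    rwa [hstate, Measure.map_apply (InvSpace.measurable_of _ _) hA'] at this
  tfae_have 1 → 4 := by
    intro h Y _ _ s _ hdet hinv
    refine hdet.isDeterministicState_comp fun B hB => h.zero_or_one _ ?_
    -- Level sets of `s x B` inherit almost sure invariance from `s`.
    refine isASInvariantSet_iff.2 ⟨s.measurable_coe hB (measurableSet_singleton 1), fun σ => ?_⟩
    filter_upwards [asInvariant_iff.1 hinv σ B hB] with x hx
    exact congrArg (· = 1) hx
  tfae_have 4 → 5 := by
    intro h
    have hprob := hμ.isProbabilityMeasure
    have := h _ (empiricalKernel X) (asDeterministic_deterministic p measurable_empirical)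
      hμ.asInvariant_empirical
    rw [hμ.isInvariantObject.isMorphism.preserves] at this
    exact this.exists_eq_dirac
  tfae_have 5 → 7 := by
    rintro ⟨q, rfl⟩
    refine ⟨q, ?_⟩
    rw [← hμ.mixture, Measure.dirac_bind (Kernel.measurable _), iidKernel_apply]
  tfae_have 7 → 6 := by
    rintro ⟨q, rfl⟩
    exact iIndepFun_infinitePi (X := fun _ : ℕ => (id : X → X)) fun _ => measurable_id
  tfae_have 6 → 7 := by
    intro h
    -- Swapping `0` and `i` shows that all marginals coincide.
    have hm : ∀ i, p.map (fun x => x i) = p.map fun x => x 0 := by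
      intro i
      conv_rhs => rw [← hp.map_reindex (Equiv.swap 0 i).injective]
      rw [Measure.map_map (measurable_pi_apply 0) (measurable_reindex _)]
      congr 1
    refine ⟨⟨p.map fun x => x 0,
      Measure.isProbabilityMeasure_map (measurable_pi_apply 0).aemeasurable⟩, ?_⟩
    have h' := (iIndepFun_iff_map_fun_eq_infinitePi_map measurable_pi_apply).1 h
    simp_rw [hm] at h'
    exact Measure.map_id.symm.trans h'
  tfae_have 7 → 1 := by
    rintro ⟨q, rfl⟩
    refine ⟨hp, fun A hA => ?_⟩
    obtain ⟨hA, hinv⟩ := isASInvariantSet_iff.1 hA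
    exact iidLaw_zero_or_one q hA hinv
  tfae_have 4 → 3 := by
    intro h
    have hid : IsMorphism pinv pinv Kernel.id := ⟨inferInstance, Measure.id_comp⟩
    -- `r` factors through itself by the identity, whose determinism is reflected back to `r`.
    have hdet : ASDeterministic p r := (hr.deterministic_iff Z pinv r Kernel.id hr.isMorphism
      hr.invariant hid (by rw [Kernel.id_comp]; exact fun B _ => ae_of_all _ fun _ => rfl)).2
      (asDeterministic_deterministic pinv measurable_id)
    rw [← hr.isMorphism.preserves]
    exact h Z r hdet hr.invariant
  tfae_have 3 → 4 := by
    intro h Y _ _ s hs hdet hinv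
    obtain ⟨g, hg, hgs⟩ := hr.exists_factor Y (s ∘ₘ p) s ⟨hs, rfl⟩ hinv
    have := hg.isMarkovKernel
    have hgdet := (hr.deterministic_iff Y (s ∘ₘ p) s g ⟨hs, rfl⟩ hinv hg hgs).1 hdet
    rw [← hg.preserves]
    exact hgdet.isDeterministicState_comp fun B hB =>
      isDeterministicState_iff.1 h _ (g.measurable_coe hB (measurableSet_singleton 1))
  tfae_finish
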